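/- Let $\tau_0\in\mathbb{R}$ and let $(\hat R,\hat\Sigma_+)$ be a real solution, on the half-line $\tau>\tau_0$, of the planar system $$\hat R'=\hat\Sigma_+(1+\hat\Sigma_+)\hat R,\qquad \hat\Sigma_+'=-\hat\Sigma_+(1-\hat\Sigma_+^2)-\hat R^2,$$ where a prime denotes $d/d\tau$, with $\hat R>0$ and $\hat\Omega:=1-\hat\Sigma_+^2-\hat R^2>0$ for all $\tau>\tau_0$. Then there is a constant $C_R\in\mathbb{R}$ (depending on the solution) such that, as $\tau\to+\infty$, $$\hat R=\frac{1}{\sqrt{2\tau}}\left[1-\frac{1}{4\tau}\left(\ln\tau+C_R\right)+O(T^2)\right],$$ $$\hat\Sigma_+=-\frac{1}{2\tau}\left[1-\frac{1}{2\tau}\left(\ln\tau+C_R-2\right)+O(T^2)\right],$$ where $T=\frac{\ln\tau}{\tau}$. -/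

import Mathlib

open Filter Asymptotics

/-- `(R, S)` (with `S` standing for `Σ̂₊`) solves the truncated differential equations
`R' = S (1 + S) R`, `S' = -S (1 - S²) - R²` for all times `τ > τ₀`. -/
def IsTruncatedSolution (τ₀ : ℝ) (R S : ℝ → ℝ) : Prop :=
  ∀ τ : ℝ, τ₀ < τ →
    HasDerivAt R (S τ * (1 + S τ) * R τ) τ ∧
    HasDerivAt S (-(S τ) * (1 - S τ ^ 2) - R τ ^ 2) τ

/-- The truncated density parameter `Ω̂ = 1 - Σ̂₊² - R̂²`. -/
def truncatedOmega (R S : ℝ → ℝ) (τ : ℝ) : ℝ := 1 - S τ ^ 2 - R τ ^ 2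

/-- The function `T = ln τ / τ` in which the error terms are expressed. -/
noncomputable def errorScale (τ : ℝ) : ℝ := Real.log τ / τ

/-!
The argument is a center manifold expansion at the fixed point `(R, S) = (0, 0)`.

The density parameter satisfies `Ω' = 2 S² Ω`, so it is nondecreasing, bounded by `1` and hence
convergent. The derivative of `S³` is dominated by a multiple of `Ω'`, so `S³` converges too; its
limit is `0`, since otherwise `Ω` would grow without bound. Then `S'` converges to
`lim Ω - 1`, which has to vanish, and therefore `R → 0`
(`tendsto_zero_of_isTruncatedSolution`).

Near the origin put `S = -R² - 2 R⁴ + u R⁶`. The remainder `u` solves a linear equation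
`u' = -a u + b` with `a → 1` and `b` bounded, so it is bounded
(`isBigO_one_centerManifold_remainder`). Hence `y = 1 / R²` satisfies `y' = 2 + 2 / y + O(1 / y²)`.
In the derivative of `y - 2 τ - log y` the terms `2` and `2 / y` cancel, so this derivative is
`O(1 / τ²)` and `y = 2 τ + log y + c + O(1 / τ)` (`exists_inv_sq_sub_log_isBigO`). Replacing `log y`
by `log (2 τ) + O(T)` gives `y / (2 τ) = 1 + (log τ + C) / (2 τ) + O(T²)` with `C = c + log 2`
(`exists_isBigO_rescaled`). Both expansions follow by Taylor expansion of `R = y^(-1/2)` and of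
`S = -1 / y - 2 / y² + O(1 / y³)`.
-/

/-! ### Functions controlled by their derivatives near infinity -/

theorem monotoneOn_Ici_of_hasDerivAt_nonneg {f f' : ℝ → ℝ} {a : ℝ}
    (hf : ∀ t, a ≤ t → HasDerivAt f (f' t) t) (h : ∀ t, a ≤ t → 0 ≤ f' t) :
    MonotoneOn f (Set.Ici a) := by
  refine monotoneOn_of_deriv_nonneg (convex_Ici a)
    (fun t ht => (hf t ht).continuousAt.continuousWithinAt)
    (fun t ht => (hf t (interior_subset ht)).differentiableAt.differentiableWithinAt) ?_
  intro t ht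
  rw [(hf t (interior_subset ht)).deriv]
  exact h t (interior_subset ht)

theorem MonotoneOn.exists_tendsto_atTop {f : ℝ → ℝ} {a M : ℝ}
    (hf : MonotoneOn f (Set.Ici a)) (hM : ∀ t, a ≤ t → f t ≤ M) :
    ∃ l, Tendsto f atTop (nhds l) ∧ ∀ t, a ≤ t → f t ≤ l := by
  have hmono : Monotone fun t => f (max a t) := fun s t hst =>
    hf (le_max_left a s) (le_max_left a t) (max_le_max le_rfl hst)
  have hbdd : BddAbove (Set.range fun t => f (max a t)) :=
    ⟨M, by rintro _ ⟨t, rfl⟩; exact hM _ (le_max_left a t)⟩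
  refine ⟨_, (tendsto_atTop_ciSup hmono hbdd).congr' ?_, fun t ht => ?_⟩
  · filter_upwards [eventually_ge_atTop a] with t ht
    rw [max_eq_right ht]
  · simpa [max_eq_right ht] using le_ciSup hbdd t

theorem tendsto_atTop_of_hasDerivAt_ge {f f' : ℝ → ℝ} {k : ℝ} (hk : 0 < k)
    (hf : ∀ᶠ t in atTop, HasDerivAt f (f' t) t) (h : ∀ᶠ t in atTop, k ≤ f' t) :
    Tendsto f atTop atTop := by
  obtain ⟨a, ha⟩ := eventually_atTop.1 (hf.and h)
  have hmono : MonotoneOn (fun t => f t - k * t) (Set.Ici a) :=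
    monotoneOn_Ici_of_hasDerivAt_nonneg (f' := fun t => f' t - k * 1)
      (fun t ht => (ha t ht).1.sub ((hasDerivAt_id t).const_mul k))
      (fun t ht => by linarith [(ha t ht).2])
  refine tendsto_atTop_mono' atTop (f₁ := fun t => (f a - k * a) + k * t) ?_
    (tendsto_atTop_add_const_left _ _ (tendsto_id.const_mul_atTop hk))
  filter_upwards [eventually_ge_atTop a] with t ht
  have : f a - k * a ≤ f t - k * t := hmono Set.self_mem_Ici ht ht
  linarith

/-- A function whose derivative is dominated by that of a convergent function `g` converges, and
its distance to the limit is at most that of `g`. -/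
theorem exists_abs_sub_le_of_abs_deriv_le {f f' g g' : ℝ → ℝ} {m : ℝ}
    (hf : ∀ᶠ t in atTop, HasDerivAt f (f' t) t) (hg : ∀ᶠ t in atTop, HasDerivAt g (g' t) t)
    (h : ∀ᶠ t in atTop, |f' t| ≤ g' t) (hm : Tendsto g atTop (nhds m)) :
    ∃ c, ∀ᶠ t in atTop, |f t - c| ≤ m - g t := by
  obtain ⟨a, ha⟩ := eventually_atTop.1 (hf.and (hg.and h))
  have hadd : MonotoneOn (fun t => g t + f t) (Set.Ici a) :=
    monotoneOn_Ici_of_hasDerivAt_nonneg (f' := fun t => g' t + f' t)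
      (fun t ht => (ha t ht).2.1.add (ha t ht).1)
      (fun t ht => by linarith [neg_abs_le (f' t), (ha t ht).2.2])
  have hsub : MonotoneOn (fun t => g t - f t) (Set.Ici a) :=
    monotoneOn_Ici_of_hasDerivAt_nonneg (f' := fun t => g' t - f' t)
      (fun t ht => (ha t ht).2.1.sub (ha t ht).1)
      (fun t ht => by linarith [le_abs_self (f' t), (ha t ht).2.2])
  have hgmono : MonotoneOn g (Set.Ici a) :=
    monotoneOn_Ici_of_hasDerivAt_nonneg (fun t ht => (ha t ht).2.1)
      (fun t ht => (abs_nonneg _).trans (ha t ht).2.2)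
  have hgm : ∀ t, a ≤ t → g t ≤ m := fun t ht =>
    ge_of_tendsto hm ((eventually_ge_atTop t).mono fun s hs => hgmono ht (ht.trans hs) hs)
  obtain ⟨l, hl, hle⟩ := hadd.exists_tendsto_atTop (M := 2 * m - (g a - f a)) (fun t ht => by
    have h1 : g a - f a ≤ g t - f t := hsub Set.self_mem_Ici ht ht
    linarith [hgm t ht])
  have hl' : Tendsto (fun t => g t - f t) atTop (nhds (2 * m - l)) :=
    ((hm.const_mul 2).sub hl).congr fun t => by ring
  refine ⟨l - m, (eventually_ge_atTop a).mono fun t ht => abs_le.2 ⟨?_, ?_⟩⟩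
  · have : g t - f t ≤ 2 * m - l :=
      ge_of_tendsto hl' ((eventually_ge_atTop t).mono fun s hs => hsub ht (ht.trans hs) hs)
    linarith
  · linarith [hle t ht]

/-- Solutions of the damped linear equation `u' = -a u + b` are bounded as soon as the damping `a`
stays away from `0` and the forcing `b` is bounded. -/
theorem isBigO_one_of_hasDerivAt_damped {u a b : ℝ → ℝ}
    (hu : ∀ᶠ t in atTop, HasDerivAt u (-a t * u t + b t) t)
    (ha : ∀ᶠ t in atTop, 1 / 2 ≤ a t) (hb : b =O[atTop] (fun _ => (1 : ℝ))) :
    u =O[atTop] (fun _ => (1 : ℝ)) := by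
  obtain ⟨B, hB⟩ := hb.bound
  obtain ⟨s, hs⟩ := eventually_atTop.1 (hu.and (ha.and hB))
  -- `(u²)' ≤ -u² + 2 B |u| ≤ -u² / 2 + 2 B²`, so `exp (t / 2) * (u² - 4 B²)` is nonincreasing.
  have hmono : MonotoneOn (fun t => Real.exp (t / 2) * (4 * B ^ 2 - u t ^ 2)) (Set.Ici s) := by
    refine monotoneOn_Ici_of_hasDerivAt_nonneg
      (f' := fun t => Real.exp (t / 2) * (1 / 2) * (4 * B ^ 2 - u t ^ 2) +
        Real.exp (t / 2) * (-(2 * u t * (-a t * u t + b t)))) (fun t ht => ?_) (fun t ht => ?_)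
    · have h1 : HasDerivAt (fun t : ℝ => Real.exp (t / 2)) (Real.exp (t / 2) * (1 / 2)) t :=
        ((hasDerivAt_id t).div_const 2).exp
      have h2 := ((hs t ht).1.fun_pow 2).const_sub (4 * B ^ 2)
      refine (h1.mul h2).congr_deriv ?_
      push_cast
      ring
    · obtain ⟨-, h1, h2⟩ := hs t ht
      simp only [Real.norm_eq_abs, abs_one, mul_one] at h2
      have h3 : u t * b t ≤ |u t| * B := (le_abs_self _).trans (by rw [abs_mul]; gcongr)
      have h4 : 0 ≤ 1 / 2 * (4 * B ^ 2 - u t ^ 2) + -(2 * u t * (-a t * u t + b t)) := by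
        nlinarith [sq_nonneg (|u t| - 2 * B), sq_abs (u t),
          mul_nonneg (sub_nonneg.2 h1) (sq_nonneg (u t))]
      have := mul_nonneg (Real.exp_pos (t / 2)).le h4
      linarith
  refine IsBigO.of_bound (Real.sqrt (4 * B ^ 2 + u s ^ 2)) ?_
  filter_upwards [eventually_ge_atTop s] with t ht
  have h1 : Real.exp (s / 2) * (4 * B ^ 2 - u s ^ 2) ≤
    Real.exp (t / 2) * (4 * B ^ 2 - u t ^ 2) := hmono Set.self_mem_Ici ht ht
  have h2 : Real.exp (s / 2) ≤ Real.exp (t / 2) := Real.exp_le_exp.2 (by linarith)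
  have h3 : u t ^ 2 ≤ 4 * B ^ 2 + u s ^ 2 := by
    by_contra! hlt
    nlinarith [Real.exp_pos (s / 2), Real.exp_pos (t / 2), sq_nonneg (u s),
      mul_le_mul_of_nonneg_right h2 (sq_nonneg (u s)), mul_nonneg (Real.exp_pos (s / 2)).le
        (sq_nonneg B)]
  simp only [Real.norm_eq_abs, abs_one, mul_one]
  exact Real.abs_le_sqrt h3

/-! ### Convergence to the fixed point -/

theorem hasDerivAt_truncatedOmega {τ₀ τ : ℝ} {R S : ℝ → ℝ} (hsol : IsTruncatedSolution τ₀ R S)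
    (hτ : τ₀ < τ) :
    HasDerivAt (truncatedOmega R S) (2 * S τ ^ 2 * truncatedOmega R S τ) τ := by
  have h := ((((hsol τ hτ).2.pow 2).const_sub 1).sub ((hsol τ hτ).1.pow 2))
  refine h.congr_deriv ?_
  simp only [truncatedOmega]
  push_cast
  ring

/-- Every solution with `Ω̂ > 0` tends to the fixed point `(0, 0)`. -/
theorem tendsto_zero_of_isTruncatedSolution {τ₀ : ℝ} {R S : ℝ → ℝ}
    (hsol : IsTruncatedSolution τ₀ R S) (hΩ : ∀ τ : ℝ, τ₀ < τ → 0 < truncatedOmega R S τ) :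
    Tendsto R atTop (nhds 0) ∧ Tendsto S atTop (nhds 0) := by
  set Ω := truncatedOmega R S with hΩdef
  have hΩeq : ∀ τ, S τ ^ 2 + R τ ^ 2 = 1 - Ω τ := fun τ => by
    simp only [hΩdef, truncatedOmega]; ring
  have hlt : ∀ {τ}, τ₀ + 1 ≤ τ → τ₀ < τ := fun h => by linarith
  have hd : ∀ τ, τ₀ + 1 ≤ τ → HasDerivAt Ω (2 * S τ ^ 2 * Ω τ) τ := fun τ h =>
    hasDerivAt_truncatedOmega hsol (hlt h)
  have hge : ∀ᶠ τ in atTop, τ₀ + 1 ≤ τ := eventually_ge_atTop _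
  have hmono : MonotoneOn Ω (Set.Ici (τ₀ + 1)) :=
    monotoneOn_Ici_of_hasDerivAt_nonneg hd fun τ h => by have := hΩ τ (hlt h); positivity
  obtain ⟨m, hm, -⟩ := hmono.exists_tendsto_atTop (M := 1)
    fun τ _ => by nlinarith [hΩeq τ, sq_nonneg (S τ), sq_nonneg (R τ)]
  set ω := Ω (τ₀ + 1) with hω
  have hωpos : 0 < ω := hΩ _ (by linarith)
  have hωle : ∀ τ, τ₀ + 1 ≤ τ → ω ≤ Ω τ := fun τ h => hmono Set.self_mem_Ici h h
  have hSabs : ∀ τ, τ₀ + 1 ≤ τ → |S τ| ≤ 1 := fun τ h => by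
    rw [abs_le_one_iff_mul_self_le_one]
    nlinarith [hΩeq τ, sq_nonneg (R τ), hΩ τ (hlt h)]
  -- `|(S³)'| ≤ 6 S² ≤ (3 / ω) Ω'`, so `S³` converges along with `Ω`.
  obtain ⟨c, hc⟩ := exists_abs_sub_le_of_abs_deriv_le (f := fun τ => S τ ^ 3)
    (f' := fun τ => 3 * S τ ^ 2 * (-(S τ) * (1 - S τ ^ 2) - R τ ^ 2))
    (g := fun τ => 3 / ω * Ω τ) (g' := fun τ => 3 / ω * (2 * S τ ^ 2 * Ω τ))
    (hge.mono fun τ h => by simpa using (hsol τ (hlt h)).2.fun_pow 3)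
    (hge.mono fun τ h => (hd τ h).const_mul _)
    (hge.mono fun τ h => by
      have h1 := abs_le.1 (hSabs τ h)
      have h2 := hΩ τ (hlt h)
      have h3 : |-(S τ) * (1 - S τ ^ 2) - R τ ^ 2| ≤ 2 := by
        rw [abs_le]
        constructor <;> nlinarith [hΩeq τ, sq_nonneg (S τ), sq_nonneg (R τ)]
      have h4 : 1 ≤ Ω τ / ω := (one_le_div hωpos).2 (hωle τ h)
      rw [abs_mul, abs_of_nonneg (by positivity : 0 ≤ 3 * S τ ^ 2)]
      calc 3 * S τ ^ 2 * |-(S τ) * (1 - S τ ^ 2) - R τ ^ 2| ≤ 3 * S τ ^ 2 * 2 := by gcongr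
        _ ≤ 3 * S τ ^ 2 * 2 * (Ω τ / ω) := le_mul_of_one_le_right (by positivity) h4
        _ = 3 / ω * (2 * S τ ^ 2 * Ω τ) := by ring)
    (hm.const_mul (3 / ω))
  have hS3 : Tendsto (fun τ => S τ ^ 3) atTop (nhds c) := by
    rw [tendsto_iff_norm_sub_tendsto_zero]
    refine squeeze_zero' (Eventually.of_forall fun _ => norm_nonneg _) hc ?_
    simpa using (hm.const_mul (3 / ω)).const_sub (3 / ω * m)
  -- If `c ≠ 0`, then `Ω' = 2 S² Ω` stays away from `0`, although `Ω` is bounded.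
  have hc0 : c = 0 := by
    by_contra hne
    have hcpos := abs_pos.2 hne
    have hev : ∀ᶠ τ in atTop, |c| / 2 < |S τ ^ 3| :=
      hS3.abs.eventually_const_lt (by linarith)
    refine not_tendsto_nhds_of_tendsto_atTop (tendsto_atTop_of_hasDerivAt_ge
      (k := |c| * ω) (by positivity) (hge.mono hd) ?_) m hm
    filter_upwards [hev, hge] with τ h1 h
    have h2 : |S τ ^ 3| ≤ S τ ^ 2 := by
      rw [pow_succ, abs_mul, abs_of_nonneg (sq_nonneg (S τ))]
      exact mul_le_of_le_one_right (sq_nonneg _) (hSabs τ h)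
    exact mul_le_mul (by linarith) (hωle τ h) hωpos.le (by positivity)
  have hS : Tendsto S atTop (nhds 0) := by
    subst hc0
    rw [Metric.tendsto_nhds]
    intro e he
    have := hS3.abs.eventually_lt_const (u := e ^ 3) (by simpa using pow_pos he 3)
    filter_upwards [this] with τ h
    rw [abs_pow] at h
    simpa using lt_of_pow_lt_pow_left₀ 3 he.le h
  have hR2 : Tendsto (fun τ => R τ ^ 2) atTop (nhds (1 - m)) := by
    have := (hm.const_sub 1).sub (hS.pow 2)
    simp only [ne_eq, OfNat.ofNat_ne_zero, not_false_eq_true, zero_pow, sub_zero] at this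
    exact this.congr fun τ => by linarith [hΩeq τ]
  -- If `m < 1`, then `S' → m - 1 < 0`, although `S → 0`.
  have hm1 : 1 - m = 0 := by
    by_contra hne
    have hpos : 0 < 1 - m :=
      lt_of_le_of_ne (ge_of_tendsto' hR2 fun τ => sq_nonneg _) (Ne.symm hne)
    have hlim : Tendsto (fun τ => -(-(S τ) * (1 - S τ ^ 2) - R τ ^ 2)) atTop
        (nhds (1 - m)) := by
      have := ((hS.neg.mul ((hS.pow 2).const_sub 1)).sub hR2).neg
      simpa using this
    exact not_tendsto_nhds_of_tendsto_atTop (tendsto_atTop_of_hasDerivAt_ge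
      (f := fun τ => -S τ) (half_pos hpos) (hge.mono fun τ h => (hsol τ (hlt h)).2.neg)
      ((hlim.eventually_const_lt (half_lt_self hpos)).mono fun _ h => h.le)) _ hS.neg
  refine ⟨?_, hS⟩
  rw [hm1] at hR2
  rw [tendsto_zero_iff_abs_tendsto_zero]
  have := hR2.sqrt
  simpa [Real.sqrt_sq_eq_abs, Function.comp_def] using this

/-! ### The center manifold -/

/-- The orbit follows the center manifold `S = -R² - 2 R⁴ + O(R⁶)` of the origin. -/
theorem isBigO_one_centerManifold_remainder {τ₀ : ℝ} {R S : ℝ → ℝ}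
    (hsol : IsTruncatedSolution τ₀ R S) (hR : ∀ τ : ℝ, τ₀ < τ → 0 < R τ)
    (hR0 : Tendsto R atTop (nhds 0)) (hS0 : Tendsto S atTop (nhds 0)) :
    (fun τ => (S τ + R τ ^ 2 + 2 * R τ ^ 4) / R τ ^ 6) =O[atTop] (fun _ => (1 : ℝ)) := by
  -- With `x = R²` and `w = S + x + 2 x²`, the remainder `u = w / x³` satisfies
  -- `u' = -(1 - g(S, x) + 6 S (1 + S)) u + h(x)` with polynomials `g`, `h` and `g(0, 0) = 0`.
  let w : ℝ × ℝ → ℝ := fun p => p.1 + p.2 + 2 * p.2 ^ 2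
  let q : ℝ → ℝ := fun x => x + 2 * x ^ 2
  let g : ℝ × ℝ → ℝ := fun p =>
    w p ^ 2 - 3 * w p * q p.2 + 3 * q p.2 ^ 2 + 2 * p.2 + 2 * (w p - 2 * q p.2) * p.2 +
      8 * p.2 ^ 2 + 8 * (w p - 2 * q p.2) * p.2 ^ 2
  let h : ℝ → ℝ := fun x =>
    -(1 + 2 * x) ^ 3 - 4 + 2 * (1 + 2 * x) ^ 2 - 8 * (1 + 2 * x) + 8 * x * (1 + 2 * x) ^ 2
  have hx0 : Tendsto (fun τ => R τ ^ 2) atTop (nhds 0) := by simpa using hR0.pow 2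
  have hp0 : Tendsto (fun τ => (S τ, R τ ^ 2)) atTop (nhds (0, 0)) := hS0.prodMk_nhds hx0
  refine isBigO_one_of_hasDerivAt_damped
    (a := fun τ => 1 - g (S τ, R τ ^ 2) + 6 * (S τ * (1 + S τ))) (b := fun τ => h (R τ ^ 2))
    ?_ ?_ ?_
  · filter_upwards [eventually_gt_atTop τ₀] with τ hτ
    obtain ⟨hdR, hdS⟩ := hsol τ hτ
    have hRne := (hR τ hτ).ne'
    have hd := ((hdS.fun_add (hdR.fun_pow 2)).fun_add ((hdR.fun_pow 4).const_mul 2)).fun_div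
      (hdR.fun_pow 6) (pow_ne_zero 6 hRne)
    refine hd.congr_deriv ?_
    simp only [g, h, w, q]
    push_cast
    field_simp
    ring
  · have hcont : Continuous fun p : ℝ × ℝ => 1 - g p + 6 * (p.1 * (1 + p.1)) := by
      simp only [g, w, q]
      fun_prop
    have hlim := (hcont.tendsto (0, 0)).comp hp0
    have h1 : (1 : ℝ) - g (0, 0) + 6 * (0 * (1 + 0)) = 1 := by simp [g, w, q]
    simp only [h1] at hlim
    exact (hlim.eventually_const_lt (by norm_num : (1 / 2 : ℝ) < 1)).mono fun _ h => h.le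
  · have hcont : Continuous h := by simp only [h]; fun_prop
    exact ((hcont.tendsto 0).comp hx0).isBigO_one ℝ

theorem hasDerivAt_inv_sq {τ₀ τ : ℝ} {R S : ℝ → ℝ} (hsol : IsTruncatedSolution τ₀ R S)
    (hτ : τ₀ < τ) (hR : R τ ≠ 0) :
    HasDerivAt (fun t => (R t ^ 2)⁻¹) (-2 * S τ * (1 + S τ) * (R τ ^ 2)⁻¹) τ := by
  refine (((hsol τ hτ).1.fun_pow 2).fun_inv (pow_ne_zero 2 hR)).congr_deriv ?_
  push_cast
  field_simp

/-- On the center manifold, `y = 1 / R²` satisfies `y' = 2 + 2 / y + O(1 / y²)`; the right-hand side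
is stated in terms of `R² = 1 / y`. -/
theorem exists_deriv_inv_sq_eq {τ₀ : ℝ} {R S : ℝ → ℝ}
    (hsol : IsTruncatedSolution τ₀ R S) (hR : ∀ τ : ℝ, τ₀ < τ → 0 < R τ)
    (hR0 : Tendsto R atTop (nhds 0)) (hS0 : Tendsto S atTop (nhds 0)) :
    ∃ v : ℝ → ℝ, v =O[atTop] (fun _ => (1 : ℝ)) ∧ ∀ τ, τ₀ < τ →
      HasDerivAt (fun t => (R t ^ 2)⁻¹) (2 + 2 * R τ ^ 2 + R τ ^ 4 * v τ) τ := by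
  set u : ℝ → ℝ := fun τ => (S τ + R τ ^ 2 + 2 * R τ ^ 4) / R τ ^ 6 with hu
  have huO : u =O[atTop] (fun _ => (1 : ℝ)) :=
    isBigO_one_centerManifold_remainder hsol hR hR0 hS0
  refine ⟨fun τ => -8 - 8 * R τ ^ 2 + (2 * R τ ^ 2 + 4 * R τ ^ 4 - 2 * (1 + S τ)) * u τ, ?_, ?_⟩
  · have h1 : Tendsto (fun τ => -8 - 8 * R τ ^ 2) atTop (nhds (-8 - 8 * 0 ^ 2)) :=
      ((hR0.pow 2).const_mul 8).const_sub (-8)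
    have h2 : Tendsto (fun τ => 2 * R τ ^ 2 + 4 * R τ ^ 4 - 2 * (1 + S τ)) atTop
        (nhds (2 * 0 ^ 2 + 4 * 0 ^ 4 - 2 * (1 + 0))) :=
      (((hR0.pow 2).const_mul 2).add ((hR0.pow 4).const_mul 4)).sub ((hS0.const_add 1).const_mul 2)
    exact (h1.isBigO_one ℝ).add (((h2.isBigO_one ℝ).mul huO).congr_right fun _ => one_mul _)
  · intro τ hτ
    have hRne := (hR τ hτ).ne'
    refine (hasDerivAt_inv_sq hsol hτ hRne).congr_deriv ?_
    simp only [hu]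
    field_simp
    ring

/-! ### Asymptotics of `1 / R²` -/

/-- `1 / R²` grows like `2 τ`; these cruder bounds suffice to start the expansion. -/
theorem eventually_inv_sq_mem_Icc {R v : ℝ → ℝ} {τ₀ : ℝ} (hR0 : Tendsto R atTop (nhds 0))
    (hv : v =O[atTop] (fun _ => (1 : ℝ)))
    (hd : ∀ τ, τ₀ < τ → HasDerivAt (fun t => (R t ^ 2)⁻¹) (2 + 2 * R τ ^ 2 + R τ ^ 4 * v τ) τ) :
    ∀ᶠ τ in atTop, τ ≤ (R τ ^ 2)⁻¹ ∧ (R τ ^ 2)⁻¹ ≤ 3 * τ := by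
  have hlim : Tendsto (fun τ => 2 + 2 * R τ ^ 2 + R τ ^ 4 * v τ) atTop (nhds 2) := by
    have h1 : Tendsto (fun τ => R τ ^ 4 * v τ) atTop (nhds 0) := by
      have h4 : (fun τ => R τ ^ 4) =o[atTop] (fun _ => (1 : ℝ)) :=
        (isLittleO_one_iff ℝ).2 (by simpa using hR0.pow 4)
      have := h4.mul_isBigO hv
      simp only [mul_one] at this
      exact (isLittleO_one_iff ℝ).1 this
    simpa using (((hR0.pow 2).const_mul 2).const_add 2).add h1
  have hgt := eventually_gt_atTop τ₀
  have hlow : Tendsto (fun τ => (R τ ^ 2)⁻¹ - τ) atTop atTop :=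
    tendsto_atTop_of_hasDerivAt_ge (k := 1 / 2) (by norm_num)
      (hgt.mono fun τ h => (hd τ h).fun_sub (hasDerivAt_id' τ))
      ((hlim.eventually_const_lt (by norm_num : (3 / 2 : ℝ) < 2)).mono fun τ h => by linarith)
  have hup : Tendsto (fun τ => 3 * τ - (R τ ^ 2)⁻¹) atTop atTop :=
    tendsto_atTop_of_hasDerivAt_ge (k := 1 / 2) (by norm_num)
      (hgt.mono fun τ h => ((hasDerivAt_id' τ).const_mul 3).fun_sub (hd τ h))
      ((hlim.eventually_lt_const (by norm_num : (2 : ℝ) < 5 / 2)).mono fun τ h => by linarith)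
  filter_upwards [hlow.eventually_ge_atTop 0, hup.eventually_ge_atTop 0] with τ h1 h2
  exact ⟨by linarith, by linarith⟩

/-- Integrating `y' = 2 + 2 / y + O(1 / y²)` for `y = 1 / R²` gives
`y = 2 τ + log y + c + O(1 / τ)`. -/
theorem exists_inv_sq_sub_log_isBigO {R v : ℝ → ℝ} {τ₀ : ℝ} (hR : ∀ τ : ℝ, τ₀ < τ → 0 < R τ)
    (hR0 : Tendsto R atTop (nhds 0)) (hv : v =O[atTop] (fun _ => (1 : ℝ)))
    (hd : ∀ τ, τ₀ < τ → HasDerivAt (fun t => (R t ^ 2)⁻¹) (2 + 2 * R τ ^ 2 + R τ ^ 4 * v τ) τ) :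
    ∃ c : ℝ, (fun τ => (R τ ^ 2)⁻¹ - 2 * τ - Real.log (R τ ^ 2)⁻¹ - c) =O[atTop]
      (fun τ => τ⁻¹) := by
  -- The derivative of `y - 2 τ - log y` is `O(1 / y²)`, hence `O(1 / τ²)`.
  have hb : (fun τ => v τ - 2 - R τ ^ 2 * v τ) =O[atTop] (fun _ => (1 : ℝ)) := by
    have h := (hv.sub (isBigO_const_const (2 : ℝ) one_ne_zero atTop)).sub
      ((((hR0.pow 2).isBigO_one ℝ).mul hv).congr_right fun _ => one_mul _)
    simpa using h
  obtain ⟨K, hK0, hK⟩ := hb.exists_nonneg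
  have hlimit : Tendsto (fun τ : ℝ => -K * τ⁻¹) atTop (nhds 0) := by
    simpa using tendsto_inv_atTop_zero.const_mul (-K)
  obtain ⟨c, hc⟩ := exists_abs_sub_le_of_abs_deriv_le
    (f := fun τ => (R τ ^ 2)⁻¹ - 2 * τ - Real.log (R τ ^ 2)⁻¹)
    (f' := fun τ => R τ ^ 4 * (v τ - 2 - R τ ^ 2 * v τ))
    (g := fun τ => -K * τ⁻¹) (g' := fun τ => -K * -(τ ^ 2)⁻¹)
    ((eventually_gt_atTop τ₀).mono fun τ h => by
      have hRne := (hR τ h).ne'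
      refine (((hd τ h).fun_sub ((hasDerivAt_id' τ).const_mul 2)).fun_sub
        ((hd τ h).log (inv_ne_zero (pow_ne_zero 2 hRne)))).congr_deriv ?_
      field_simp
      ring)
    ((eventually_ne_atTop 0).mono fun τ h => (hasDerivAt_inv h).const_mul (-K))
    (by
      filter_upwards [hK.bound, eventually_inv_sq_mem_Icc hR0 hv hd, eventually_gt_atTop 0]
        with τ h1 h2 h3
      have h4 : R τ ^ 2 ≤ τ⁻¹ := by
        simpa using inv_anti₀ h3 h2.1
      have h5 : R τ ^ 4 ≤ (τ ^ 2)⁻¹ := by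
        calc R τ ^ 4 = (R τ ^ 2) ^ 2 := by ring
          _ ≤ τ⁻¹ ^ 2 := by gcongr
          _ = (τ ^ 2)⁻¹ := inv_pow _ _
      simp only [norm_one, mul_one, Real.norm_eq_abs] at h1
      rw [abs_mul, abs_of_nonneg (by positivity)]
      calc R τ ^ 4 * |v τ - 2 - R τ ^ 2 * v τ| ≤ (τ ^ 2)⁻¹ * K := by gcongr
        _ = -K * -(τ ^ 2)⁻¹ := by ring)
    hlimit
  refine ⟨c, IsBigO.of_bound K ?_⟩
  filter_upwards [hc, eventually_gt_atTop 0] with τ h1 h2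
  rw [Real.norm_eq_abs, Real.norm_eq_abs, abs_of_pos (inv_pos.2 h2)]
  linarith

theorem isBigO_inv_errorScale : (fun τ : ℝ => τ⁻¹) =O[atTop] errorScale := by
  refine IsBigO.of_bound 1 ?_
  filter_upwards [Real.tendsto_log_atTop.eventually_ge_atTop 1, eventually_gt_atTop 0] with τ h1 h2
  rw [errorScale, norm_div, norm_inv, one_mul, div_eq_mul_inv]
  exact le_mul_of_one_le_left (by positivity) (h1.trans (le_abs_self _))

/-- The expansion in the rescaled variable `r = R √(2τ)`: `r⁻² = y / (2τ)` deviates from `1` by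
`O(T)`, and by `(log τ + C) / (2τ)` up to `O(T²)`. -/
theorem exists_isBigO_rescaled {R v : ℝ → ℝ} {τ₀ : ℝ} (hR : ∀ τ : ℝ, τ₀ < τ → 0 < R τ)
    (hR0 : Tendsto R atTop (nhds 0)) (hv : v =O[atTop] (fun _ => (1 : ℝ)))
    (hd : ∀ τ, τ₀ < τ → HasDerivAt (fun t => (R t ^ 2)⁻¹) (2 + 2 * R τ ^ 2 + R τ ^ 4 * v τ) τ) :
    ∃ C : ℝ,
      (fun τ => (R τ ^ 2)⁻¹ / (2 * τ) - 1) =O[atTop] errorScale ∧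
      (fun τ => (R τ ^ 2)⁻¹ / (2 * τ) - 1 - (Real.log τ + C) / (2 * τ)) =O[atTop]
        (fun τ => errorScale τ ^ 2) := by
  obtain ⟨c, hc⟩ := exists_inv_sq_sub_log_isBigO hR hR0 hv hd
  have hbd := eventually_inv_sq_mem_Icc hR0 hv hd
  have hlog1 : (fun _ : ℝ => (1 : ℝ)) =O[atTop] Real.log :=
    (isLittleO_const_left.2 (Or.inr (tendsto_norm_atTop_atTop.comp Real.tendsto_log_atTop))).isBigO
  have hinv : (fun τ : ℝ => τ⁻¹) =O[atTop] (fun _ => (1 : ℝ)) :=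
    tendsto_inv_atTop_zero.isBigO_one ℝ
  have hlogy : (fun τ => Real.log (R τ ^ 2)⁻¹) =O[atTop] Real.log := by
    have h3 : (fun τ => Real.log 3 + Real.log τ) =O[atTop] Real.log :=
      ((isBigO_const_const (Real.log 3) one_ne_zero atTop).trans hlog1).add (isBigO_refl _ _)
    refine IsBigO.trans (IsBigO.of_bound 1 ?_) h3
    filter_upwards [hbd, eventually_ge_atTop 1] with τ h1 h2
    have h4 : 0 ≤ Real.log (R τ ^ 2)⁻¹ := Real.log_nonneg (h2.trans h1.1)
    rw [← Real.log_mul (by norm_num) (by linarith), one_mul, Real.norm_eq_abs, abs_of_nonneg h4]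
    exact (Real.log_le_log (by linarith [h1.1]) h1.2).trans (le_abs_self _)
  have heps : (fun τ => (R τ ^ 2)⁻¹ / (2 * τ) - 1) =O[atTop] errorScale := by
    have h1 : (fun τ => (R τ ^ 2)⁻¹ - 2 * τ) =O[atTop] Real.log := by
      have := ((hc.trans (hinv.trans hlog1)).add hlogy).add
        ((isBigO_const_const c one_ne_zero atTop).trans hlog1)
      exact this.congr_left fun τ => by ring
    have h2 := h1.mul (isBigO_const_mul_self (1 / 2 : ℝ) (fun τ : ℝ => τ⁻¹) atTop)
    refine h2.congr' ?_ (Eventually.of_forall fun τ => (div_eq_mul_inv _ _).symm)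
    filter_upwards [eventually_gt_atTop 0] with τ h
    field_simp
  refine ⟨c + Real.log 2, heps, ?_⟩
  -- The error is `log (y / (2τ)) / (2τ) + O(1 / τ²)`, and `|log (1 + ε)| ≤ 2 |ε|` for `ε ≥ -1/2`.
  have hlog : (fun τ => Real.log ((R τ ^ 2)⁻¹ / (2 * τ))) =O[atTop] errorScale := by
    refine IsBigO.trans (IsBigO.of_bound 2 ?_) heps
    filter_upwards [hbd, eventually_gt_atTop 0] with τ h1 h2
    set s := (R τ ^ 2)⁻¹ / (2 * τ) with hs
    have hs2 : 1 / 2 ≤ s := by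
      rw [hs, le_div_iff₀ (by positivity)]
      linarith [h1.1]
    have hspos : 0 < s := by linarith
    have h3 := Real.log_le_sub_one_of_pos hspos
    have h4 := Real.one_sub_inv_le_log_of_pos hspos
    have h5 : -(2 * |s - 1|) ≤ 1 - s⁻¹ := by
      have h6 : 1 - s⁻¹ = (s - 1) * s⁻¹ := by field_simp
      have h7 : s⁻¹ ≤ 2 := by simpa using inv_anti₀ (by norm_num) hs2
      have h8 : |1 - s⁻¹| ≤ |s - 1| * 2 := by
        rw [h6, abs_mul, abs_of_pos (inv_pos.2 hspos)]
        gcongr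
      linarith [neg_abs_le (1 - s⁻¹)]
    rw [Real.norm_eq_abs, Real.norm_eq_abs, abs_le]
    exact ⟨by linarith, by linarith [le_abs_self (s - 1), abs_nonneg (s - 1)]⟩
  have h1 := ((hc.trans isBigO_inv_errorScale).add hlog).mul
    ((isBigO_const_mul_self (1 / 2 : ℝ) (fun τ : ℝ => τ⁻¹) atTop).trans isBigO_inv_errorScale)
  refine h1.congr' ?_ (Eventually.of_forall fun τ => (sq _).symm)
  filter_upwards [hbd, eventually_gt_atTop 0] with τ h2 h3
  have h4 : (0 : ℝ) < (R τ ^ 2)⁻¹ := by linarith [h2.1]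
  rw [Real.log_div h4.ne' (by positivity), Real.log_mul two_ne_zero h3.ne']
  field_simp
  ring

/-! ### The expansions of `R` and `S` -/

theorem theorem3 (τ₀ : ℝ) (R S : ℝ → ℝ) (hsol : IsTruncatedSolution τ₀ R S)
    (hΩ : ∀ τ : ℝ, τ₀ < τ → 0 < truncatedOmega R S τ)
    (hR : ∀ τ : ℝ, τ₀ < τ → 0 < R τ) :
    ∃ C_R : ℝ, ∃ E₁ E₂ : ℝ → ℝ,
      E₁ =O[atTop] (fun τ => errorScale τ ^ 2) ∧
      E₂ =O[atTop] (fun τ => errorScale τ ^ 2) ∧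
      (∀ᶠ τ in atTop,
        R τ = 1 / Real.sqrt (2 * τ) *
          (1 - 1 / (4 * τ) * (Real.log τ + C_R) + E₁ τ)) ∧
      (∀ᶠ τ in atTop,
        S τ = -(1 / (2 * τ)) *
          (1 - 1 / (2 * τ) * (Real.log τ + C_R - 2) + E₂ τ)) := by
  obtain ⟨hR0, hS0⟩ := tendsto_zero_of_isTruncatedSolution hsol hΩ
  have hu := isBigO_one_centerManifold_remainder hsol hR hR0 hS0
  set u : ℝ → ℝ := fun τ => (S τ + R τ ^ 2 + 2 * R τ ^ 4) / R τ ^ 6 with hudef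
  obtain ⟨v, hv, hd⟩ := exists_deriv_inv_sq_eq hsol hR hR0 hS0
  obtain ⟨C, heps, hepsq⟩ := exists_isBigO_rescaled hR hR0 hv hd
  have hbd := eventually_inv_sq_mem_Icc hR0 hv hd
  set ε : ℝ → ℝ := fun τ => (R τ ^ 2)⁻¹ / (2 * τ) - 1 with hε
  set q : ℝ → ℝ := fun τ => (Real.log τ + C) / (2 * τ) with hq
  set r : ℝ → ℝ := fun τ => R τ * Real.sqrt (2 * τ) with hr
  have hrsq : ∀ {τ : ℝ}, 0 < τ → r τ ^ 2 = R τ ^ 2 * (2 * τ) := fun h => by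
    rw [hr, mul_pow, Real.sq_sqrt (by positivity)]
  have hpos : ∀ᶠ τ : ℝ in atTop, 0 < τ ∧ 0 < R τ ∧ 0 < r τ := by
    filter_upwards [eventually_gt_atTop 0, eventually_gt_atTop τ₀] with τ h1 h2
    exact ⟨h1, hR τ h2, mul_pos (hR τ h2) (Real.sqrt_pos.2 (by positivity))⟩
  have hεr : ∀ᶠ τ in atTop, ε τ = (1 - r τ ^ 2) / r τ ^ 2 := by
    filter_upwards [hpos] with τ ⟨h1, h2, _⟩
    rw [hrsq h1, hε]
    field_simp
  have hrO : r =O[atTop] (fun _ => (1 : ℝ)) := by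
    refine IsBigO.of_bound 2 ?_
    filter_upwards [hpos, hbd] with τ ⟨h1, h2, h3⟩ h4
    have h5 : R τ ^ 2 ≤ τ⁻¹ := by simpa using inv_anti₀ h1 h4.1
    have h6 : r τ ^ 2 ≤ 2 := by
      rw [hrsq h1]
      calc R τ ^ 2 * (2 * τ) ≤ τ⁻¹ * (2 * τ) := by gcongr
        _ = 2 := by field_simp
    rw [Real.norm_eq_abs, abs_of_pos h3, norm_one]
    nlinarith
  have hrpow : ∀ n : ℕ, (fun τ => r τ ^ n) =O[atTop] (fun _ => (1 : ℝ)) := fun n => by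
    simpa using hrO.pow n
  have heps2 : (fun τ => ε τ ^ 2) =O[atTop] (fun τ => errorScale τ ^ 2) := heps.pow 2
  -- Second-order Taylor estimates for `r = (1 + ε)^(-1/2)` and `r² = (1 + ε)⁻¹`.
  have hT1 : (fun τ => r τ - 1 + ε τ / 2) =O[atTop] (fun τ => errorScale τ ^ 2) := by
    have hfac : (fun τ => r τ ^ 2 * (2 * r τ + 1) / (2 * (1 + r τ) ^ 2)) =O[atTop]
        (fun _ => (1 : ℝ)) := by
      refine IsBigO.trans (IsBigO.of_bound 1 ?_)
        ((hrO.const_mul_left 2).add (isBigO_refl (fun _ => (1 : ℝ)) atTop))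
      filter_upwards [hpos] with τ ⟨_, _, h⟩
      rw [Real.norm_eq_abs, Real.norm_eq_abs, abs_of_pos (by positivity),
        abs_of_pos (by positivity), one_mul, div_le_iff₀ (by positivity), mul_comm]
      gcongr
      nlinarith
    refine (heps2.mul hfac).congr' ?_ (Eventually.of_forall fun τ => mul_one _)
    filter_upwards [hpos, hεr] with τ ⟨_, _, h⟩ h2
    have : (1 + r τ) ≠ 0 := by positivity
    simp only [h2]
    field_simp
    ring
  have hT2 : (fun τ => r τ ^ 2 - 1 + ε τ) =O[atTop] (fun τ => errorScale τ ^ 2) := by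
    refine (heps2.mul (hrpow 2)).congr' ?_ (Eventually.of_forall fun τ => mul_one _)
    filter_upwards [hpos, hεr] with τ ⟨_, _, h⟩ h2
    simp only [h2]
    field_simp
    ring
  have hr4 : (fun τ => (r τ ^ 4 - 1) * τ⁻¹) =O[atTop] (fun τ => errorScale τ ^ 2) := by
    have h1 : (fun τ => r τ ^ 4 - 1) =O[atTop] errorScale := by
      refine (heps.mul ((hrpow 4).add (hrpow 2)).neg_left).congr' ?_
        (Eventually.of_forall fun τ => mul_one _)
      filter_upwards [hpos, hεr] with τ ⟨_, _, h⟩ h2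
      simp only [h2]
      field_simp
      ring
    exact (h1.mul isBigO_inv_errorScale).congr_right fun τ => (sq _).symm
  have hu6 : (fun τ => u τ * r τ ^ 6 / 4 * τ⁻¹ ^ 2) =O[atTop] (fun τ => errorScale τ ^ 2) := by
    have := ((hu.mul (hrpow 6)).const_mul_left (1 / 4)).mul (isBigO_inv_errorScale.pow 2)
    simp only [one_mul] at this
    exact this.congr_left fun τ => by ring
  refine ⟨C, fun τ => (r τ - 1 + ε τ / 2) - 1 / 2 * (ε τ - q τ),
    fun τ => (r τ ^ 2 - 1 + ε τ) - (ε τ - q τ) + (r τ ^ 4 - 1) * τ⁻¹ - u τ * r τ ^ 6 / 4 * τ⁻¹ ^ 2,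
    hT1.sub (hepsq.const_mul_left _), ((hT2.sub hepsq).add hr4).sub hu6, ?_, ?_⟩
  · filter_upwards [hpos] with τ ⟨h1, _, _⟩
    have h2 : Real.sqrt (2 * τ) ≠ 0 := (Real.sqrt_pos.2 (by positivity)).ne'
    have h3 : (1 - 1 / (4 * τ) * (Real.log τ + C) +
        ((r τ - 1 + ε τ / 2) - 1 / 2 * (ε τ - q τ))) = r τ := by
      simp only [hq]
      field_simp
      ring
    rw [h3, hr]
    field_simp
  · filter_upwards [hpos] with τ ⟨h1, h2, _⟩
    have h4 : r τ ^ 4 = (R τ ^ 2 * (2 * τ)) ^ 2 := by rw [← hrsq h1]; ring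
    have h6 : r τ ^ 6 = (R τ ^ 2 * (2 * τ)) ^ 3 := by rw [← hrsq h1]; ring
    rw [h4, h6, hrsq h1]
    simp only [hq, hudef]
    field_simp
    ring
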